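/- Let $k,n\ge 1$ be integers. Let $F_0^k=0$, $F_1^k=1$, $F_{j+2}^k=kF_{j+1}^k+F_j^k$ ($j\ge 0$) be the fractional Fibonacci numbers (the superscript $k$ is a label, not an exponent), and let $$\mathcal F^{(k)}(n)=G_n(x_0x_1^kx_2^{-1})=\langle x_0,\dots,x_{n-1}\mid x_ix_{i+1}^kx_{i+2}^{-1}\ (0\le i<n)\rangle,$$ with subscripts taken modulo $n$, be the fractional Fibonacci group. Write $\mathbb Z_m=\mathbb Z/m\mathbb Z$ and let $G^{\mathrm{ab}}$ denote the abelianization of $G$. (1) $\mathcal F^{(k)}(n)^{\mathrm{ab}}\cong \mathbb Z_\alpha\oplus\mathbb Z_\beta$, where $$\alpha=\gcd(F_n^k,\;F_{n-1}^k-1)\neq 0,\qquad \beta=\frac{F_{n+1}^k+F_{n-1}^k-1-(-1)^n}{\alpha},$$ and $\beta$ is a non-negative integer. (2) Explicitly, $$\mathcal F^{(k)}(n)^{\mathrm{ab}}\cong\begin{cases} \mathbb Z_{F_{n+1}^k+F_{n-1}^k} & \text{if } n\equiv 1,5,7,11 \bmod 12,\\ \mathbb Z_{\gcd(k+1,2)}\oplus\mathbb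 Z_{(F_{n+1}^k+F_{n-1}^k)/\gcd(k+1,2)} & \text{if } n\equiv 3,9\bmod 12,\\ \mathbb Z_{F_{n/2+1}^k+F_{n/2-1}^k}\oplus\mathbb Z_{F_{n/2+1}^k+F_{n/2-1}^k} & \text{if } n\equiv 2,6,10\bmod 12,\\ \mathbb Z_{\gcd(k,2)F_{n/2}^k}\oplus\mathbb Z_{(k^2+4)F_{n/2}^k/\gcd(k,2)} & \text{if } n\equiv 0,4,8\bmod 12, \end{cases}$$ where all the displayed quotients are integers. -/

import Mathlib

/-- The cyclically presented group `G_n(w)`: generators `x_i` indexed by the residues `i` mod `n`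
(`n ≥ 1`), and as relators the `n` words obtained from `w` by shifting all subscripts
by `i` mod `n`. -/
abbrev CyclicallyPresentedGroup (n : ℕ) (w : FreeGroup (ZMod n)) : Type :=
  PresentedGroup (Set.range fun i : ZMod n => FreeGroup.map (fun j => j + i) w)

/-- The fractional Fibonacci group `G_n(x_0 x_1^k x_2⁻¹)`, subscripts taken mod `n`. -/
abbrev FractionalFibonacciGroup (k n : ℕ) : Type :=
  CyclicallyPresentedGroup n
    (FreeGroup.of (0 : ZMod n) * FreeGroup.of (1 : ZMod n) ^ k * (FreeGroup.of (2 : ZMod n))⁻¹)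

/-- The fractional Fibonacci numbers: `fracFib k n` is `F_n^k` (here `k` is a label, not an
exponent). -/
def fracFib (k : ℕ) : ℕ → ℕ
  | 0 => 0
  | 1 => 1
  | j + 2 => k * fracFib k (j + 1) + fracFib k j

/-! ### Identities and parities of the fractional Fibonacci numbers. -/

section FracFib

/-! In the abelianization the relators become the linear recurrence, so `x_0` and `x_1` generate and
the only relations left are `x_n = x_0` and `x_{n+1} = x_1`. The group is thus the cokernel of `M ^
n - 1` on ℤ², with `M` the companion matrix. Its entries have gcd `α = gcd(F_n, F_{n-1} - 1)`, and
by Cassini its determinant is, up to sign, `F_{n+1} + F_{n-1} - 1 - (-1)^n`; the Smith normal form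
gives (1). `nonempty_addEquiv_of_bezout` carries it out by hand, with mutually inverse
homomorphisms.

For (2) only `α` has to be computed: it divides 2 for odd `n`, and for even `n` doubling formulas
and Cassini split off a common factor of index `n/2`. -/

theorem fracFib_add_two (k j : ℕ) :
    fracFib k (j + 2) = k * fracFib k (j + 1) + fracFib k j := rfl

theorem fracFib_pos {k : ℕ} (hk : 1 ≤ k) (j : ℕ) : 0 < fracFib k (j + 1) := by
  induction j with
  | zero => exact Nat.one_pos
  | succ j ih =>
    rw [fracFib_add_two]
    exact Nat.add_pos_left (Nat.mul_pos hk ih) _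

/-- Cassini's identity. -/
theorem fracFib_cassini (k j : ℕ) :
    (fracFib k (j + 2) : ℤ) * fracFib k j - (fracFib k (j + 1) : ℤ) ^ 2 = (-1) ^ (j + 1) := by
  induction j with
  | zero => simp [fracFib]
  | succ j ih =>
    rw [pow_succ _ (j + 1), ← ih, fracFib_add_two k (j + 1), fracFib_add_two k j]
    push_cast
    ring

theorem fracFib_add (k i j : ℕ) :
    fracFib k (i + j + 1) =
      fracFib k (i + 1) * fracFib k (j + 1) + fracFib k i * fracFib k j := by
  induction i using Nat.twoStepInduction with
  | zero => simp [fracFib]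
  | one => simp [fracFib, Nat.add_comm 1 j]
  | more i h₁ h₂ =>
    rw [show i + 2 + j + 1 = (i + j + 1) + 2 by ring, fracFib_add_two,
      show i + j + 1 + 1 = i + 1 + j + 1 by ring, h₂, h₁, fracFib_add_two k (i + 1),
      fracFib_add_two k i]
    ring

theorem fracFib_two_mul_add_one (k m : ℕ) :
    fracFib k (2 * m + 1) = fracFib k (m + 1) ^ 2 + fracFib k m ^ 2 := by
  rw [two_mul, fracFib_add]
  ring

theorem fracFib_two_mul_add_two (k m : ℕ) :
    fracFib k (2 * m + 2) = fracFib k (m + 1) * (fracFib k (m + 2) + fracFib k m) := by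
  rw [show 2 * m + 2 = m + (m + 1) + 1 by ring, fracFib_add]
  ring

theorem fracFib_coprime (k j : ℕ) : Nat.Coprime (fracFib k (j + 1)) (fracFib k j) := by
  induction j with
  | zero => simp [fracFib]
  | succ j ih =>
    rw [fracFib_add_two, Nat.coprime_mul_right_add_left]
    exact ih.symm

theorem fracFib_mod_two_of_even {k : ℕ} (hk : k % 2 = 0) (j : ℕ) :
    fracFib k j % 2 = j % 2 := by
  induction j using Nat.twoStepInduction with
  | zero => rfl
  | one => rfl
  | more j h₁ _ =>
    rw [fracFib_add_two, Nat.add_mod, Nat.mul_mod, hk, h₁]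
    simp

theorem fracFib_mod_two_of_odd {k : ℕ} (hk : k % 2 = 1) (j : ℕ) :
    fracFib k (3 * j) % 2 = 0 ∧ fracFib k (3 * j + 1) % 2 = 1 ∧ fracFib k (3 * j + 2) % 2 = 1 := by
  have step (i : ℕ) : fracFib k (i + 2) % 2 = (fracFib k (i + 1) + fracFib k i) % 2 := by
    rw [fracFib_add_two, Nat.add_mod, Nat.mul_mod, hk, one_mul, Nat.mod_mod, ← Nat.add_mod]
  induction j with
  | zero => simpa [fracFib] using hk
  | succ j ih =>
    have h₁ := step (3 * j + 1)
    have h₂ := step (3 * j + 2)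
    have h₃ := step (3 * j + 3)
    rw [show 3 * (j + 1) = 3 * j + 3 by ring]
    simp only [Nat.add_assoc, Nat.reduceAdd] at h₁ h₂ h₃ ⊢
    omega

end FracFib

/-! ### Solutions of the recurrence in an abelian group. -/

section LinearRecurrence

variable {B : Type*} [AddCommGroup B] {k : ℕ}

theorem eq_fracFib_nsmul_add {y : ℕ → B} (hy : ∀ j, y (j + 2) = k • y (j + 1) + y j) (j : ℕ) :
    y (j + 1) = fracFib k (j + 1) • y 1 + fracFib k j • y 0 := by
  induction j using Nat.twoStepInduction with
  | zero => simp [fracFib]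
  | one => simp [fracFib, hy 0]
  | more j h₁ h₂ =>
    rw [hy (j + 1), h₁, h₂, fracFib_add_two k (j + 1), fracFib_add_two k j]
    module

theorem periodic_of_recurrence {y : ℕ → B} (hy : ∀ j, y (j + 2) = k • y (j + 1) + y j) {n : ℕ}
    (h₀ : y n = y 0) (h₁ : y (n + 1) = y 1) : Function.Periodic y n := by
  intro j
  induction j using Nat.twoStepInduction with
  | zero => rwa [zero_add]
  | one => rwa [add_comm]
  | more j h h' =>
    rw [hy j, ← h, ← h', show j + 2 + n = j + n + 2 by ring, hy, show j + n + 1 = j + 1 + n by ring]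

/-- The solution of `y (j + 2) = k y (j + 1) + y j` with initial values `b₀` and `b₁`. -/
def recurrenceSeq (k : ℕ) (b₀ b₁ : B) : ℕ → B
  | 0 => b₀
  | 1 => b₁
  | j + 2 => k • recurrenceSeq k b₀ b₁ (j + 1) + recurrenceSeq k b₀ b₁ j

end LinearRecurrence

/-! ### The abelianization as a cokernel, and its diagonalisation. -/

namespace FractionalFibonacciGroup

variable {B : Type*} [AddCommGroup B] {k n : ℕ}

/-- The image of the generator `x_i` in the abelianization, written additively. -/
def abGen (k : ℕ) {n : ℕ} (i : ZMod n) : Additive (Abelianization (FractionalFibonacciGroup k n)) :=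
  Additive.ofMul (Abelianization.of (PresentedGroup.of i))

theorem abGen_add_two (i : ZMod n) : abGen k (i + 2) = k • abGen k (i + 1) + abGen k i := by
  have h := PresentedGroup.one_of_mem (rels := Set.range fun i : ZMod n =>
    FreeGroup.map (fun j => j + i) (FreeGroup.of (0 : ZMod n) * FreeGroup.of (1 : ZMod n) ^ k *
      (FreeGroup.of (2 : ZMod n))⁻¹)) ⟨i, rfl⟩
  have h' := congrArg (fun g : FractionalFibonacciGroup k n =>
    Additive.ofMul (Abelianization.of g)) h
  simp only [map_mul, map_pow, map_inv, FreeGroup.map.of, map_one, ofMul_mul, ofMul_pow, ofMul_inv,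
    ofMul_one] at h'
  rw [add_comm i 2, add_comm i 1]
  have h'' : abGen k (0 + i) + k • abGen k (1 + i) + -abGen k (2 + i) = 0 := h'
  rw [zero_add, add_neg_eq_zero] at h''
  rw [← h'', add_comm]

theorem abGen_natCast_add_one (j : ℕ) :
    abGen k ((j + 1 : ℕ) : ZMod n) =
      fracFib k (j + 1) • abGen k (1 : ZMod n) + fracFib k j • abGen k (0 : ZMod n) := by
  have := eq_fracFib_nsmul_add (k := k) (y := fun j : ℕ => abGen k (j : ZMod n))
    (fun j => by simpa using abGen_add_two (j : ZMod n)) j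
  simpa using this

theorem hom_ext [NeZero n]
    {f g : Additive (Abelianization (FractionalFibonacciGroup k n)) →+ B}
    (h₀ : f (abGen k 0) = g (abGen k 0)) (h₁ : f (abGen k 1) = g (abGen k 1)) : f = g := by
  have hgen (i : ZMod n) : f (abGen k i) = g (abGen k i) := by
    obtain ⟨j, rfl⟩ := ZMod.natCast_zmod_surjective i
    cases j with
    | zero => simpa using h₀
    | succ j => rw [abGen_natCast_add_one]; simp [h₀, h₁]
  have : AddMonoidHom.toMultiplicativeRight f = AddMonoidHom.toMultiplicativeRight g := by
    apply Abelianization.hom_ext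
    apply PresentedGroup.ext
    intro i
    exact congrArg Multiplicative.ofAdd (hgen i)
  exact AddMonoidHom.toMultiplicativeRight.injective this

/-- The hypotheses say that the solution starting at `b₀`, `b₁` returns to its initial values after
`m + 1` steps. It is then periodic, hence a function on residues that kills the relators. -/
theorem exists_hom {m : ℕ} {b₀ b₁ : B}
    (h₀ : fracFib k (m + 1) • b₁ + fracFib k m • b₀ = b₀)
    (h₁ : fracFib k (m + 2) • b₁ + fracFib k (m + 1) • b₀ = b₁) :
    ∃ f : Additive (Abelianization (FractionalFibonacciGroup k (m + 1))) →+ B,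
      f (abGen k 0) = b₀ ∧ f (abGen k 1) = b₁ := by
  set y := recurrenceSeq k b₀ b₁
  have hrec (j : ℕ) : y (j + 2) = k • y (j + 1) + y j := rfl
  have hper : Function.Periodic y (m + 1) := periodic_of_recurrence hrec
    ((eq_fracFib_nsmul_add hrec m).trans h₀) ((eq_fracFib_nsmul_add hrec (m + 1)).trans h₁)
  have hval (j : ℕ) : y (j : ZMod (m + 1)).val = y j := by
    rw [ZMod.val_natCast, hper.map_mod_nat]
  let φ : ZMod (m + 1) → Multiplicative B := fun i => Multiplicative.ofAdd (y i.val)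
  have hrel : ∀ r ∈ Set.range (fun i : ZMod (m + 1) => FreeGroup.map (fun j => j + i)
      (FreeGroup.of (0 : ZMod (m + 1)) * FreeGroup.of (1 : ZMod (m + 1)) ^ k *
      (FreeGroup.of (2 : ZMod (m + 1)))⁻¹)), FreeGroup.lift φ r = 1 := by
    rintro _ ⟨i, rfl⟩
    obtain ⟨j, rfl⟩ := ZMod.natCast_zmod_surjective i
    simp only [map_mul, map_pow, map_inv, FreeGroup.map.of, FreeGroup.lift_apply_of, zero_add, φ]
    have e₁ : y (1 + (j : ZMod (m + 1))).val = y (j + 1) := by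
      rw [← hval (j + 1), add_comm (1 : ZMod (m + 1))]; push_cast; rfl
    have e₂ : y (2 + (j : ZMod (m + 1))).val = y (j + 2) := by
      rw [← hval (j + 2), add_comm (2 : ZMod (m + 1))]; push_cast; rfl
    rw [hval, e₁, e₂, hrec, ← ofAdd_nsmul, ← ofAdd_add, ← ofAdd_neg, ← ofAdd_add, ofAdd_eq_one]
    abel
  let F : FractionalFibonacciGroup k (m + 1) →* Multiplicative B := PresentedGroup.toGroup hrel
  refine ⟨MonoidHom.toAdditiveLeft (Abelianization.lift F), ?_, ?_⟩
  · change Multiplicative.toAdd (F (PresentedGroup.of 0)) = b₀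
    rw [PresentedGroup.toGroup.of]
    change y (0 : ZMod (m + 1)).val = b₀
    exact (congrArg (fun i : ZMod (m + 1) => y i.val) Nat.cast_zero.symm).trans (hval 0)
  · change Multiplicative.toAdd (F (PresentedGroup.of 1)) = b₁
    rw [PresentedGroup.toGroup.of]
    change y (1 : ZMod (m + 1)).val = b₁
    exact (congrArg (fun i : ZMod (m + 1) => y i.val) Nat.cast_one.symm).trans (hval 1)

/-- Diagonalisation of the presentation: `α a`, `α b` are the entries of `M ^ (m + 1) - 1`
for the companion matrix `M`. -/
theorem nonempty_addEquiv_of_bezout {m α β : ℕ} {a b p q : ℤ}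
    (ha : (fracFib k (m + 1) : ℤ) = α * a) (hb : (fracFib k m : ℤ) - 1 = α * b)
    (hβ : (β : ℤ) = α * (a ^ 2 - k * a * b - b ^ 2)) (hpq : a * q - b * p = 1) :
    Nonempty (Additive (Abelianization (FractionalFibonacciGroup k (m + 1))) ≃+
      ZMod α × ZMod β) := by
  have hb' : (fracFib k m : ℤ) = α * b + 1 := by linarith
  have hc : (fracFib k (m + 2) : ℤ) = k * (α * a) + α * b + 1 := by
    rw [fracFib_add_two]; push_cast; rw [ha, hb']; ring
  have hβ' : (α : ZMod β) * (a ^ 2 - k * a * b - b ^ 2) = 0 := by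
    have := congrArg (Int.cast : ℤ → ZMod β) hβ
    push_cast at this
    rw [← this, ZMod.natCast_self]
  have hpq' (N : ℕ) : (a : ZMod N) * q - b * p = 1 := by
    exact_mod_cast congrArg (Int.cast : ℤ → ZMod N) hpq
  -- With `U = a x₁ + b x₀` and `V = p x₁ + q x₀`, a unimodular change of basis by `hpq`, one has
  -- `x₀ = -p U + a V` and `x₁ = q U - b V`.
  obtain ⟨f, hf₀, hf₁⟩ := exists_hom (B := ZMod α × ZMod β) (k := k) (m := m)
    (b₀ := ((-p : ℤ), (a : ℤ))) (b₁ := ((q : ℤ), (-b : ℤ)))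
    (by
      rw [← natCast_zsmul, ← natCast_zsmul, ha, hb']
      ext
      · simp [zsmul_eq_mul]
      · simp [zsmul_eq_mul]; ring)
    (by
      rw [← natCast_zsmul, ← natCast_zsmul, ha, hc]
      ext
      · simp [zsmul_eq_mul]
      · simp [zsmul_eq_mul]; linear_combination hβ')
  set x₀ := abGen k (0 : ZMod (m + 1))
  set x₁ := abGen k (1 : ZMod (m + 1))
  have r₀ : (α * a) • x₁ + (α * b) • x₀ = 0 := by
    have := abGen_natCast_add_one (k := k) (n := m + 1) m
    rw [ZMod.natCast_self, ← natCast_zsmul, ← natCast_zsmul, ha, hb', add_smul, one_smul,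
      ← add_assoc] at this
    exact left_eq_add.mp ((add_comm _ _).trans this.symm).symm
  have r₁ : (k * (α * a) + α * b) • x₁ + (α * a) • x₀ = 0 := by
    have := abGen_natCast_add_one (k := k) (n := m + 1) (m + 1)
    rw [Nat.cast_succ, ZMod.natCast_self, zero_add, ← natCast_zsmul, ← natCast_zsmul, ha, hc,
      add_smul _ (1 : ℤ), one_smul, add_right_comm] at this
    exact left_eq_add.mp ((add_comm _ _).trans this.symm).symm
  have hU : (zmultiplesHom _ (a • x₁ + b • x₀)) (α : ℤ) = 0 := by
    rw [zmultiplesHom_apply, ← r₀]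
    module
  -- Rewritten in `U`, `V`, the relation `r₁` is `α ((a k + b) q - a p) U + β V = 0`; subtracting
  -- that multiple of `r₀`, which is `α U = 0`, leaves `β V = 0`.
  have hV : (zmultiplesHom _ (p • x₁ + q • x₀)) (β : ℤ) = 0 := by
    have e₁ : β * p = (k * (α * a) + α * b) - ((a * k + b) * q - a * p) * (α * a) := by
      linear_combination p * hβ + α * (a * k + b) * hpq
    have e₀ : β * q = α * a - ((a * k + b) * q - a * p) * (α * b) := by
      linear_combination q * hβ + α * a * hpq
    rw [zmultiplesHom_apply, smul_add, smul_smul, smul_smul, e₁, e₀]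
    linear_combination (norm := module) r₁ - ((a * k + b) * q - a * p) • r₀
  let g : ZMod α × ZMod β →+ Additive (Abelianization (FractionalFibonacciGroup k (m + 1))) :=
    (ZMod.lift α ⟨_, hU⟩).coprod (ZMod.lift β ⟨_, hV⟩)
  have hg (r s : ℤ) : g ((r : ZMod α), (s : ZMod β)) =
      r • (a • x₁ + b • x₀) + s • (p • x₁ + q • x₀) := by
    simp [g]
  refine ⟨AddMonoidHom.toAddEquiv f g ?_ ?_⟩
  · apply hom_ext
    · change g (f x₀) = x₀
      rw [hf₀, hg]
      linear_combination (norm := module) hpq • x₀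
    · change g (f x₁) = x₁
      rw [hf₁, hg]
      linear_combination (norm := module) hpq • x₁
  · ext z : 1
    obtain ⟨r, s⟩ := z
    obtain ⟨r, rfl⟩ := ZMod.intCast_surjective r
    obtain ⟨s, rfl⟩ := ZMod.intCast_surjective s
    change f (g _) = _
    rw [hg]
    simp only [map_add, map_zsmul, hf₀, hf₁]
    ext
    · simp [zsmul_eq_mul]; linear_combination (r : ZMod α) * hpq' α
    · simp [zsmul_eq_mul]; linear_combination (s : ZMod β) * hpq' β

theorem exists_nonempty_addEquiv (hk : 1 ≤ k) (m : ℕ) :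
    ∃ α β : ℕ, α ≠ 0 ∧
      α = Int.gcd (fracFib k (m + 1) : ℤ) ((fracFib k m : ℤ) - 1) ∧
      (α : ℤ) * (β : ℤ) =
        (fracFib k (m + 2) : ℤ) + (fracFib k m : ℤ) - 1 - (-1) ^ (m + 1) ∧
      Nonempty (Additive (Abelianization (FractionalFibonacciGroup k (m + 1))) ≃+
        ZMod α × ZMod β) := by
  have hpos := fracFib_pos hk m
  have hα : 0 < Int.gcd (fracFib k (m + 1) : ℤ) ((fracFib k m : ℤ) - 1) :=
    Int.gcd_pos_of_ne_zero_left _ (by exact_mod_cast hpos.ne')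
  have hcop := Int.gcd_div_gcd_div_gcd hα
  set α := Int.gcd (fracFib k (m + 1) : ℤ) ((fracFib k m : ℤ) - 1) with hαdef
  obtain ⟨a, ha⟩ := Int.gcd_dvd_left (fracFib k (m + 1) : ℤ) ((fracFib k m : ℤ) - 1)
  obtain ⟨b, hb⟩ := Int.gcd_dvd_right (fracFib k (m + 1) : ℤ) ((fracFib k m : ℤ) - 1)
  rw [← hαdef] at ha hb
  have hα' : (0 : ℤ) < α := by exact_mod_cast hα
  rw [ha, hb, Int.mul_ediv_cancel_left _ hα'.ne', Int.mul_ediv_cancel_left _ hα'.ne'] at hcop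
  obtain ⟨u, v, huv⟩ := Int.isCoprime_iff_gcd_eq_one.mpr hcop
  have hdet : (α : ℤ) * (α * (a ^ 2 - k * a * b - b ^ 2)) =
      (fracFib k (m + 2) : ℤ) + (fracFib k m : ℤ) - 1 - (-1) ^ (m + 1) := by
    have hc := fracFib_cassini k m
    rw [fracFib_add_two] at hc ⊢
    push_cast at hc ⊢
    rw [← hc, ha, show (fracFib k m : ℤ) = α * b + 1 by linarith]
    ring
  have hnonneg : 0 ≤ (fracFib k (m + 2) : ℤ) + (fracFib k m : ℤ) - 1 - (-1) ^ (m + 1) := by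
    have h₂ : 0 < fracFib k (m + 2) := fracFib_pos hk (m + 1)
    rcases Nat.even_or_odd (m + 1) with h | h
    -- Here 2 is subtracted, so both terms must be positive; evenness of `m + 1` excludes `F_0`.
    · obtain ⟨j, rfl⟩ : ∃ j, m = j + 1 := Nat.exists_eq_succ_of_ne_zero (by rintro rfl; simp at h)
      have h₁ := fracFib_pos hk j
      rw [h.neg_one_pow]
      omega
    · rw [h.neg_one_pow]
      omega
  have hβ : 0 ≤ (α : ℤ) * (a ^ 2 - k * a * b - b ^ 2) :=
    nonneg_of_mul_nonneg_right (hdet ▸ hnonneg) hα'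
  lift (α : ℤ) * (a ^ 2 - k * a * b - b ^ 2) to ℕ using hβ with β hβ'
  exact ⟨α, β, hα.ne', rfl, hdet, nonempty_addEquiv_of_bezout ha hb hβ' (p := -v) (q := u)
    (by linarith)⟩

/-- Since `α ≠ 0`, the product formula determines `β`, so each explicit case reduces to a gcd and a
product. -/
theorem nonempty_addEquiv_of_mul_eq (hk : 1 ≤ k) {m α β : ℕ}
    (hα : Int.gcd (fracFib k (m + 1) : ℤ) ((fracFib k m : ℤ) - 1) = α)
    (hβ : (α : ℤ) * (β : ℤ) =
        (fracFib k (m + 2) : ℤ) + (fracFib k m : ℤ) - 1 - (-1) ^ (m + 1)) :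
    Nonempty (Additive (Abelianization (FractionalFibonacciGroup k (m + 1))) ≃+
        ZMod α × ZMod β) := by
  obtain ⟨α', β', hne, hα', hβ', e⟩ := exists_nonempty_addEquiv hk m
  obtain rfl : α' = α := hα'.trans hα
  obtain rfl : β' = β := by
    have h := mul_left_cancel₀ (by exact_mod_cast hne) (hβ'.trans hβ.symm)
    exact_mod_cast h
  exact e

end FractionalFibonacciGroup

/-! ### Evaluation of the gcd by the residue of the index. -/

section Gcd

/-- Modulo the gcd, `F_{m+1} = 0` and `F_{m+2} = F_m = 1`, so Cassini reads `1 = -1` and the gcd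
divides 2. Parity decides the rest. -/
theorem fracFib_gcd_of_odd {k m : ℕ} (hm : Even m) :
    Int.gcd (fracFib k (m + 1) : ℤ) ((fracFib k m : ℤ) - 1) =
      if m % 3 = 2 then Nat.gcd (k + 1) 2 else 1 := by
  set g := Int.gcd (fracFib k (m + 1) : ℤ) ((fracFib k m : ℤ) - 1) with hg
  have h₁ : (g : ℤ) ∣ (fracFib k (m + 1) : ℤ) := Int.gcd_dvd_left _ _
  have h₂ : (g : ℤ) ∣ (fracFib k m : ℤ) - 1 := Int.gcd_dvd_right _ _
  have hdvd : g ∣ 2 := by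
    have hc := fracFib_cassini k m
    rw [hm.add_one.neg_one_pow, fracFib_add_two] at hc
    push_cast at hc
    obtain ⟨a, ha⟩ := h₁
    obtain ⟨b, hb⟩ := h₂
    rw [ha, show (fracFib k m : ℤ) = g * b + 1 by linarith] at hc
    have : (g : ℤ) ∣ 2 := ⟨-(k * a * (g * b + 1) + g * b ^ 2 + 2 * b - g * a ^ 2), by
      linear_combination hc⟩
    exact_mod_cast this
  have htwo : g = if fracFib k (m + 1) % 2 = 0 ∧ fracFib k m % 2 = 1 then 2 else 1 := by
    rcases (Nat.dvd_prime Nat.prime_two).mp hdvd with h | h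
    · rw [if_neg, h]
      rintro ⟨e₁, e₂⟩
      have : ((2 : ℕ) : ℤ) ∣ g := Int.dvd_coe_gcd (by omega) (by omega)
      rw [h] at this
      norm_num at this
    · rw [h] at h₁ h₂ ⊢
      rw [if_pos (by omega)]
  rw [htwo]
  obtain ⟨r, hr⟩ := hm
  rcases Nat.mod_two_eq_zero_or_one k with hk | hk
  · have hgcd : Nat.gcd (k + 1) 2 = 1 := by
      rw [Nat.gcd_comm, Nat.gcd_rec]; simp [Nat.add_mod, hk]
    have := fracFib_mod_two_of_even hk (m + 1)
    rw [hgcd, ite_self, if_neg (by omega)]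
  · have hgcd : Nat.gcd (k + 1) 2 = 2 := by
      rw [Nat.gcd_comm, Nat.gcd_rec]; simp [Nat.add_mod, hk]
    rw [hgcd]
    have h := fracFib_mod_two_of_odd hk (m / 3)
    have h' := fracFib_mod_two_of_odd hk (m / 3 + 1)
    rw [show 3 * (m / 3 + 1) = 3 * (m / 3) + 3 by ring] at h'
    have hm3 : m = 3 * (m / 3) ∨ m = 3 * (m / 3) + 1 ∨ m = 3 * (m / 3) + 2 := by omega
    generalize m / 3 = t at *
    rcases hm3 with rfl | rfl | rfl
    · rw [if_neg (by omega), if_neg (by omega)]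
    · rw [if_neg (by simp only [Nat.add_assoc, Nat.reduceAdd]; omega), if_neg (by omega)]
    · rw [if_pos (by simp only [Nat.add_assoc, Nat.reduceAdd]; omega), if_pos (by omega)]

/-- For even `m`, Cassini gives `F_{2m+1} - 1 = F_m (F_{m+2} + F_m)`, while `F_{2m+2} = F_{m+1}
(F_{m+2} + F_m)`; the cofactors are coprime. -/
theorem fracFib_gcd_of_two_mul_odd {k m : ℕ} (hm : Even m) :
    Int.gcd (fracFib k (2 * m + 2) : ℤ) ((fracFib k (2 * m + 1) : ℤ) - 1) =
      fracFib k (m + 2) + fracFib k m := by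
  have hc := fracFib_cassini k m
  rw [hm.add_one.neg_one_pow] at hc
  rw [fracFib_two_mul_add_two, fracFib_two_mul_add_one,
    show ((fracFib k (m + 1) ^ 2 + fracFib k m ^ 2 : ℕ) : ℤ) - 1 =
      ((fracFib k m * (fracFib k (m + 2) + fracFib k m) : ℕ) : ℤ) by
        push_cast; linear_combination -hc,
    Int.gcd_natCast_natCast, Nat.gcd_mul_right, fracFib_coprime, one_mul]

/-- The Lucas-type sums satisfy the same recurrence, so Euclid's algorithm descends to `gcd(k, k² +
2)`. -/
theorem fracFib_lucas_gcd (k m : ℕ) :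
    Nat.gcd (fracFib k (m + 2) + fracFib k m) (fracFib k (m + 3) + fracFib k (m + 1)) =
      Nat.gcd k 2 := by
  induction m with
  | zero =>
    rw [show fracFib k (0 + 2) + fracFib k 0 = k by simp [fracFib],
      show fracFib k (0 + 3) + fracFib k (0 + 1) = 2 + k * k by simp [fracFib]; ring,
      Nat.gcd_add_mul_left_right]
  | succ m ih =>
    rw [← ih, show fracFib k (m + 1 + 3) + fracFib k (m + 1 + 1) =
      (fracFib k (m + 2) + fracFib k m) + k * (fracFib k (m + 3) + fracFib k (m + 1)) by
        rw [fracFib_add_two k (m + 2), fracFib_add_two k m]; ring]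
    rw [Nat.gcd_add_mul_right_right, Nat.gcd_comm]

/-- With the opposite sign in Cassini the common factor is `F_{m+2}`, and the cofactors are
consecutive Lucas-type sums. -/
theorem fracFib_gcd_of_four_dvd {k m : ℕ} (hm : Even m) :
    Int.gcd (fracFib k (2 * m + 4) : ℤ) ((fracFib k (2 * m + 3) : ℤ) - 1) =
      Nat.gcd k 2 * fracFib k (m + 2) := by
  have hc := fracFib_cassini k (m + 1)
  rw [hm.add_one.add_one.neg_one_pow] at hc
  rw [show 2 * m + 4 = 2 * (m + 1) + 2 by ring, show 2 * m + 3 = 2 * (m + 1) + 1 by ring,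
    fracFib_two_mul_add_two, fracFib_two_mul_add_one,
    show ((fracFib k (m + 1 + 1) ^ 2 + fracFib k (m + 1) ^ 2 : ℕ) : ℤ) - 1 =
      ((fracFib k (m + 2) * (fracFib k (m + 2) + fracFib k m) : ℕ) : ℤ) by
        rw [← hc, fracFib_add_two k (m + 1), fracFib_add_two k m]; push_cast; ring,
    Int.gcd_natCast_natCast, Nat.gcd_mul_left, Nat.gcd_comm (fracFib k (m + 1 + 2) + _),
    fracFib_lucas_gcd, mul_comm]

end Gcd

/-! ### Assembly of the cases. -/

theorem theorem4p2 (k n : ℕ) (hk : 1 ≤ k) (hn : 1 ≤ n) :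
    -- the formula with gcds; here `α` is nonzero, so `β` is the (exact) quotient
    (∃ α β : ℕ, α ≠ 0 ∧
      α = Int.gcd (fracFib k n : ℤ) ((fracFib k (n - 1) : ℤ) - 1) ∧
      (α : ℤ) * (β : ℤ) = (fracFib k (n + 1) : ℤ) + (fracFib k (n - 1) : ℤ) - 1 - (-1) ^ n ∧
      Nonempty (Additive (Abelianization (FractionalFibonacciGroup k n)) ≃+
        ZMod α × ZMod β)) ∧
    -- the explicit form according to `n` mod 12
    ((n % 12 = 1 ∨ n % 12 = 5 ∨ n % 12 = 7 ∨ n % 12 = 11) →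
      Nonempty (Additive (Abelianization (FractionalFibonacciGroup k n)) ≃+
        ZMod (fracFib k (n + 1) + fracFib k (n - 1)))) ∧
    ((n % 12 = 3 ∨ n % 12 = 9) →
      Nat.gcd (k + 1) 2 ∣ fracFib k (n + 1) + fracFib k (n - 1) ∧
      Nonempty (Additive (Abelianization (FractionalFibonacciGroup k n)) ≃+
        ZMod (Nat.gcd (k + 1) 2) ×
          ZMod ((fracFib k (n + 1) + fracFib k (n - 1)) / Nat.gcd (k + 1) 2))) ∧
    ((n % 12 = 2 ∨ n % 12 = 6 ∨ n % 12 = 10) →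
      Nonempty (Additive (Abelianization (FractionalFibonacciGroup k n)) ≃+
        ZMod (fracFib k (n / 2 + 1) + fracFib k (n / 2 - 1)) ×
          ZMod (fracFib k (n / 2 + 1) + fracFib k (n / 2 - 1)))) ∧
    ((n % 12 = 0 ∨ n % 12 = 4 ∨ n % 12 = 8) →
      Nat.gcd k 2 ∣ (k ^ 2 + 4) * fracFib k (n / 2) ∧
      Nonempty (Additive (Abelianization (FractionalFibonacciGroup k n)) ≃+
        ZMod (Nat.gcd k 2 * fracFib k (n / 2)) ×
          ZMod ((k ^ 2 + 4) * fracFib k (n / 2) / Nat.gcd k 2))) := by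
  obtain ⟨m, rfl⟩ : ∃ m, n = m + 1 := ⟨n - 1, by omega⟩
  refine ⟨FractionalFibonacciGroup.exists_nonempty_addEquiv hk m, ?_, ?_, ?_, ?_⟩
  · intro h
    have hm : Even m := Nat.even_iff.mpr (by omega)
    obtain ⟨e⟩ := FractionalFibonacciGroup.nonempty_addEquiv_of_mul_eq hk (α := 1)
      (β := fracFib k (m + 2) + fracFib k m)
      (by rw [fracFib_gcd_of_odd hm, if_neg (by omega)])
      (by rw [hm.add_one.neg_one_pow]; push_cast; ring)
    exact ⟨e.trans AddEquiv.uniqueProd⟩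
  · intro h
    have hm : Even m := Nat.even_iff.mpr (by omega)
    have hg := fracFib_gcd_of_odd (k := k) hm
    rw [if_pos (by omega)] at hg
    have hdvd : Nat.gcd (k + 1) 2 ∣ fracFib k (m + 1 + 1) + fracFib k (m + 1 - 1) := by
      -- For odd `n` the product formula in (1) is itself the divisibility.
      obtain ⟨α, β, -, hα, hβ, -⟩ := FractionalFibonacciGroup.exists_nonempty_addEquiv hk m
      rw [hm.add_one.neg_one_pow] at hβ
      refine ⟨β, ?_⟩
      rw [← hg, ← hα, add_tsub_cancel_right]
      zify
      linarith
    refine ⟨hdvd, FractionalFibonacciGroup.nonempty_addEquiv_of_mul_eq hk hg ?_⟩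
    rw [hm.add_one.neg_one_pow]
    have := Nat.mul_div_cancel' hdvd
    rw [← Nat.cast_mul, this]
    push_cast
    simp
  · intro h
    obtain ⟨r, rfl⟩ : ∃ r, m = 2 * r + 1 := ⟨m / 2, by omega⟩
    have hr : Even r := Nat.even_iff.mpr (by omega)
    rw [show (2 * r + 1 + 1) / 2 = r + 1 by omega]
    refine FractionalFibonacciGroup.nonempty_addEquiv_of_mul_eq hk
      (fracFib_gcd_of_two_mul_odd hr) ?_
    -- Cassini turns `F_{n+1} + F_{n-1} - 2` into the square of `F_{n/2+1} + F_{n/2-1}`.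
    have hc := fracFib_cassini k r
    rw [hr.add_one.neg_one_pow] at hc
    rw [Even.neg_one_pow ⟨r + 1, by ring⟩, fracFib_add_two k (2 * r + 1), fracFib_two_mul_add_two,
      fracFib_two_mul_add_one]
    rw [fracFib_add_two] at hc ⊢
    push_cast at hc ⊢
    linear_combination 2 * hc
  · intro h
    obtain ⟨r, rfl⟩ : ∃ r, m = 2 * r + 3 := ⟨(m - 3) / 2, by omega⟩
    have hr : Even r := Nat.even_iff.mpr (by omega)
    rw [show (2 * r + 3 + 1) / 2 = r + 2 by omega]
    have hdvd : Nat.gcd k 2 ∣ k ^ 2 + 4 :=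
      dvd_add (dvd_pow (Nat.gcd_dvd_left k 2) two_ne_zero)
        ((Nat.gcd_dvd_right k 2).trans (by norm_num))
    refine ⟨hdvd.mul_right _, FractionalFibonacciGroup.nonempty_addEquiv_of_mul_eq hk
      (fracFib_gcd_of_four_dvd hr) ?_⟩
    rw [← Nat.cast_mul, mul_right_comm, Nat.mul_div_cancel' (hdvd.mul_right _)]
    -- Now the same quantity equals `(k² + 4) F_{n/2}²`, as `n/2` is even.
    have hc := fracFib_cassini k (r + 1)
    rw [hr.add_one.add_one.neg_one_pow] at hc
    rw [Even.neg_one_pow ⟨r + 2, by ring⟩, fracFib_add_two k (2 * r + 3),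
      show 2 * r + 3 + 1 = 2 * (r + 1) + 2 by ring, show 2 * r + 3 = 2 * (r + 1) + 1 by ring,
      fracFib_two_mul_add_two, fracFib_two_mul_add_one]
    rw [fracFib_add_two k (r + 1)] at hc ⊢
    push_cast at hc ⊢
    linear_combination -2 * hc
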